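/- Let $f(x,W)=\sum_{j=1}^k\langle w_j,x\rangle^2=x^\top W^\top Wx$ be the two-layer network with quadratic activation, input $x\in\mathbb R^d$ and weight matrix $W\in\mathbb R^{k\times d}$ with rows $w_1,\dots,w_k$. For $M\ge 0$ let $\Sigma(M)=\{W\in\mathbb R^{k\times d}:\|W\|_F\le M\}$, and for a sample $S=(x_1,\dots,x_n)$ of points of $\mathbb R^d$ let \[ R_S(\Sigma(M))=\frac1n\,\mathbb E_\sigma\Big[\sup_{W\in\Sigma(M)}\sum_{i=1}^n\sigma_i f(x_i,W)\Big] \] be the empirical Rademacher complexity of the class $\{f(\cdot,W):W\in\Sigma(M)\}$, where $\sigma_1,\dots,\sigma_n$ are independent with $\mathbb P(\sigma_i=1)=\mathbb P(\sigma_i=-1)=1/2$. There is an absolute constant $C>0$ such that for all integers $d,k,n\ge 1$ with $n\ge d\log d$ and all $M\ge 0$, if $x_1,\dots,x_n$ are independent with $x_i\sim N(0,I_d)$, then with probability at least $1-C/d$ over the sample $S=(x_1,\dots,x_n)$, \[ R_S(\Sigma(M))\le C\sqrt{\frac{M^4d}{n}}. \] -/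

import Mathlib

open MeasureTheory ProbabilityTheory

noncomputable section

/-- The empirical Rademacher complexity of a class `F` of real functions on a sample `S` of size
`n`: `(1 / n) * 𝔼_σ [sup_{f ∈ F} ∑ i, σ i * f (S i)]`.  The signs `σ i` are independent and each is
`1` or `-1` with probability `1 / 2`, so `σ` is uniform on `{1, -1} ^ n` and the expectation is the
average over the `2 ^ n` sign vectors.  The real supremum is meaningful when the class is non-empty
and the sums are bounded above; for the class used below see `bddAbove_quadraticNetClass`. -/
def rademacherComplexity {α : Type*} {n : ℕ} (F : Set (α → ℝ)) (S : Fin n → α) : ℝ :=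
  (1 / (n : ℝ)) *
    ((1 / 2 ^ n) * ∑ σ : Fin n → ℤˣ, ⨆ f : F, ∑ i, ((σ i : ℤ) : ℝ) * (f : α → ℝ) (S i))

/-- The two-layer network with quadratic activation `z ↦ z ^ 2`, all second-layer weights equal
to `1`, and hidden-layer weights `w_j` given by the rows of the `k × d` matrix `W`:
`f(x, W) = ∑ j, ⟨w_j, x⟩ ^ 2 = xᵀ Wᵀ W x`. -/
def quadraticNet {k d : ℕ} (W : Matrix (Fin k) (Fin d) ℝ) (x : EuclideanSpace ℝ (Fin d)) : ℝ :=
  ∑ j, (∑ l, W j l * x l) ^ 2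

section

attribute [local instance] Matrix.frobeniusNormedAddCommGroup

/-- `Σ(M)`: the `k × d` real matrices whose Frobenius norm is at most `M`. -/
def frobeniusBall (k d : ℕ) (M : ℝ) : Set (Matrix (Fin k) (Fin d) ℝ) :=
  {W | ‖W‖ ≤ M}

lemma sum_sq_le_of_mem_frobeniusBall {k d : ℕ} {M : ℝ} {W : Matrix (Fin k) (Fin d) ℝ}
    (hW : W ∈ frobeniusBall k d M) : ∑ j, ∑ l, W j l ^ 2 ≤ M ^ 2 := by
  have h0 : 0 ≤ ‖W‖ := norm_nonneg W
  have h1 : ‖W‖ ≤ M := hW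
  have h2 : ‖W‖ ^ 2 = ∑ j, ∑ l, W j l ^ 2 := by
    rw [Matrix.frobenius_norm_def, ← Real.sqrt_eq_rpow, Real.sq_sqrt (by positivity)]
    simp
  rw [← h2]
  gcongr

end

/-- The class of the networks `x ↦ f(x, W)`, `W ∈ Σ(M)`, with `k` hidden units. -/
def quadraticNetClass (k d : ℕ) (M : ℝ) : Set (EuclideanSpace ℝ (Fin d) → ℝ) :=
  quadraticNet '' frobeniusBall k d M

lemma quadraticNet_le {k d : ℕ} {M : ℝ} {W : Matrix (Fin k) (Fin d) ℝ}
    (hW : W ∈ frobeniusBall k d M) (x : EuclideanSpace ℝ (Fin d)) :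
    quadraticNet W x ≤ M ^ 2 * ∑ l, x l ^ 2 := by
  calc quadraticNet W x ≤ ∑ j, (∑ l, W j l ^ 2) * ∑ l, x l ^ 2 :=
        Finset.sum_le_sum fun j _ => Finset.sum_mul_sq_le_sq_mul_sq _ _ _
    _ = (∑ j, ∑ l, W j l ^ 2) * ∑ l, x l ^ 2 := by rw [Finset.sum_mul]
    _ ≤ M ^ 2 * ∑ l, x l ^ 2 := by
        gcongr
        exact sum_sq_le_of_mem_frobeniusBall hW

/-- The suprema in the Rademacher complexity of the network class are finite. -/
lemma bddAbove_quadraticNetClass {k d n : ℕ} (M : ℝ) (S : Fin n → EuclideanSpace ℝ (Fin d))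
    (σ : Fin n → ℤˣ) :
    BddAbove (Set.range fun f : quadraticNetClass k d M =>
      ∑ i, ((σ i : ℤ) : ℝ) * (f : EuclideanSpace ℝ (Fin d) → ℝ) (S i)) := by
  refine ⟨∑ i, M ^ 2 * ∑ l, S i l ^ 2, ?_⟩
  rintro _ ⟨⟨_, W, hW, rfl⟩, rfl⟩
  refine Finset.sum_le_sum fun i _ => ?_
  have h0 : 0 ≤ quadraticNet W (S i) := Finset.sum_nonneg fun j _ => sq_nonneg _
  have h1 := quadraticNet_le hW (S i)
  rcases Int.units_eq_one_or (σ i) with h | h <;> simp only [h] <;> push_cast <;> linarith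

end

/-! For fixed signs put `q σ v = ∑ i, σ i * ⟨v, x i⟩ ^ 2`. The signed sum of `f(·, W)` is the sum of
`q σ` over the rows of `W`, so its supremum over `Σ(M)` is at most `M ^ 2` times the supremum of `|q
σ|` on the unit ball, whatever `k` is. A `1/4`-net with at most `9 ^ d` points replaces that ball at
the cost of a factor 3 (`abs_signed_sum_sq_inner_le`). Averaging exponentials over the signs turns
the net maximum into a sum of products of `cosh (t * ⟨u, x i⟩ ^ 2)`
(`rademacherComplexity_quadraticNetClass_le`). For Gaussian samples and `t = m / 4`, each product
has mean at most `exp (n * m ^ 2)` (`integrable_prod_cosh_sq_inner`). Taking `m = √(d / n)` makes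
this `exp d`, and Markov's inequality for the sum over the net concludes. -/

/-! ### Nets of the unit ball -/

/-- A `1/4`-separated finite subset of the unit ball has at most `9 ^ dim` points. -/
theorem card_le_of_quarter_separated {E : Type*} [NormedAddCommGroup E] [NormedSpace ℝ E]
    [FiniteDimensional ℝ E] (s : Finset E) (hs : ∀ c ∈ s, ‖c‖ ≤ 1)
    (h : ∀ c ∈ s, ∀ d ∈ s, c ≠ d → 1 / 4 ≤ ‖c - d‖) :
    s.card ≤ 9 ^ Module.finrank ℝ E := by
  borelize E
  let μ : Measure E := Measure.addHaar
  have D : Set.Pairwise (s : Set E) (Function.onFun Disjoint fun c => Metric.ball c (1 / 8 : ℝ)) := by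
    rintro c hc d hd hcd
    apply Metric.ball_disjoint_ball
    rw [dist_eq_norm]
    have := h c hc d hd hcd
    linarith
  have hsub : (⋃ c ∈ s, Metric.ball c (1 / 8 : ℝ)) ⊆ Metric.ball (0 : E) (9 / 8) := by
    refine Set.iUnion₂_subset fun x hx => Metric.ball_subset_ball' ?_
    rw [dist_zero_right]
    linarith [hs x hx]
  have I : (s.card : ENNReal) * ENNReal.ofReal ((1 / 8) ^ Module.finrank ℝ E) *
      μ (Metric.ball 0 1) ≤
      ENNReal.ofReal ((9 / 8) ^ Module.finrank ℝ E) * μ (Metric.ball 0 1) := by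
    have := measure_mono (μ := μ) hsub
    rw [measure_biUnion_finset D fun c _ => measurableSet_ball] at this
    simpa only [μ.addHaar_ball_of_pos _ (by norm_num : (0 : ℝ) < 1 / 8),
      μ.addHaar_ball_of_pos _ (by norm_num : (0 : ℝ) < 9 / 8),
      Finset.sum_const, nsmul_eq_mul, mul_assoc] using this
  have J := (ENNReal.mul_le_mul_iff_left (Metric.measure_ball_pos _ _ zero_lt_one).ne'
    measure_ball_lt_top.ne).1 I
  have K : (s.card : ℝ) ≤ (9 : ℝ) ^ Module.finrank ℝ E := by
    have := ENNReal.toReal_le_of_le_ofReal (by positivity) J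
    simpa [div_eq_mul_inv, mul_pow] using this
  exact_mod_cast K

/-- The unit ball has a `1/4`-net with at most `9 ^ dim` points. -/
theorem exists_quarter_net (E : Type*) [NormedAddCommGroup E] [NormedSpace ℝ E]
    [FiniteDimensional ℝ E] :
    ∃ N : Finset E, (∀ u ∈ N, ‖u‖ ≤ 1) ∧ N.card ≤ 9 ^ Module.finrank ℝ E ∧
      ∀ v : E, ‖v‖ ≤ 1 → ∃ u ∈ N, ‖v - u‖ ≤ 1 / 4 := by
  classical
  let P : ℕ → Prop := fun m => ∃ s : Finset E, s.card = m ∧ (∀ c ∈ s, ‖c‖ ≤ 1) ∧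
    ∀ c ∈ s, ∀ d ∈ s, c ≠ d → 1 / 4 ≤ ‖c - d‖
  -- A separated set of largest cardinality is a net; the volume bound makes the search range
  -- exhaustive.
  obtain ⟨N, hcard, hN, hsep⟩ : P (Nat.findGreatest P (9 ^ Module.finrank ℝ E)) :=
    Nat.findGreatest_spec (P := P) (Nat.zero_le _) ⟨∅, by simp⟩
  refine ⟨N, hN, card_le_of_quarter_separated N hN hsep, fun v hv => ?_⟩
  by_contra! hfar
  have hvN : v ∉ N := fun hvN => by
    have := hfar v hvN
    norm_num at this
  have hins : P (N.card + 1) := by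
    refine ⟨insert v N, Finset.card_insert_of_notMem hvN, ?_, ?_⟩
    · intro c hc
      rcases Finset.mem_insert.1 hc with rfl | hc
      exacts [hv, hN c hc]
    · intro c hc d hd hcd
      rcases Finset.mem_insert.1 hc with rfl | hc' <;> rcases Finset.mem_insert.1 hd with rfl | hd'
      · exact absurd rfl hcd
      · exact (hfar d hd').le
      · rw [norm_sub_rev]
        exact (hfar c hc').le
      · exact hsep c hc' d hd' hcd
  have hle : N.card + 1 ≤ 9 ^ Module.finrank ℝ E := by
    obtain ⟨s, hs, h1, h2⟩ := hins
    exact hs ▸ card_le_of_quarter_separated s h1 h2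
  have := Nat.le_findGreatest hle hins
  omega

/-! ### From the net to the whole space -/

/-- A signed sum of squares of linear forms is controlled on the whole space by its values on a
`1/4`-net of the unit ball. -/
theorem abs_signed_sum_sq_inner_le {E : Type*} [NormedAddCommGroup E] [InnerProductSpace ℝ E]
    {ι : Type*} [Fintype ι] (a : ι → ℝ) (x : ι → E) {N : Set E} {m : ℝ}
    (hN : ∀ v : E, ‖v‖ ≤ 1 → ∃ u ∈ N, ‖v - u‖ ≤ 1 / 4) (hN1 : ∀ u ∈ N, ‖u‖ ≤ 1)
    (hm : ∀ u ∈ N, |∑ i, a i * inner ℝ u (x i) ^ 2| ≤ m) (v : E) :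
    |∑ i, a i * inner ℝ v (x i) ^ 2| ≤ 3 * m * ‖v‖ ^ 2 := by
  set q : E → ℝ := fun v => ∑ i, a i * inner ℝ v (x i) ^ 2 with hq
  change |q v| ≤ _
  have hsmul : ∀ (t : ℝ) (v : E), q (t • v) = t ^ 2 * q v := fun t v => by
    simp only [hq, real_inner_smul_left, Finset.mul_sum]
    exact Finset.sum_congr rfl fun i _ => by ring
  -- Polarization of `q v - q u = B(v - u, v + u)`, `B` being the bilinear form of `q`. The factors
  -- 2 and 1/2 cancel in `B` and balance the two norms.
  have hdiff : ∀ v u : E, 4 * (q v - q u) =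
      q ((2 : ℝ) • (v - u) + (1 / 2 : ℝ) • (v + u)) -
        q ((2 : ℝ) • (v - u) - (1 / 2 : ℝ) • (v + u)) := fun v u => by
    simp only [hq, inner_add_left, inner_sub_left, real_inner_smul_left,
      ← Finset.sum_sub_distrib, Finset.mul_sum]
    exact Finset.sum_congr rfl fun i _ => by ring
  have hbdd : BddAbove ((fun v => |q v|) '' Metric.closedBall (0 : E) 1) := by
    refine ⟨∑ i, |a i| * ‖x i‖ ^ 2, ?_⟩
    rintro _ ⟨v, hv, rfl⟩
    rw [mem_closedBall_zero_iff] at hv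
    refine (Finset.abs_sum_le_sum_abs _ _).trans (Finset.sum_le_sum fun i _ => ?_)
    rw [abs_mul, abs_pow]
    have : |inner ℝ v (x i)| ≤ ‖x i‖ :=
      (abs_real_inner_le_norm _ _).trans (mul_le_of_le_one_left (norm_nonneg _) hv)
    gcongr
  set s := sSup ((fun v => |q v|) '' Metric.closedBall (0 : E) 1) with hs
  have hle1 : ∀ v : E, ‖v‖ ≤ 1 → |q v| ≤ s := fun v hv =>
    le_csSup hbdd ⟨v, mem_closedBall_zero_iff.2 hv, rfl⟩
  have hle : ∀ v : E, |q v| ≤ s * ‖v‖ ^ 2 := fun v => by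
    rcases eq_or_ne v 0 with rfl | hv
    · simp [hq]
    have hpos : 0 < ‖v‖ := norm_pos_iff.2 hv
    have h1 : q v = ‖v‖ ^ 2 * q (‖v‖⁻¹ • v) := by
      rw [hsmul]
      field_simp
    have h2 := hle1 (‖v‖⁻¹ • v) (by rw [norm_smul, norm_inv, norm_norm, inv_mul_cancel₀ hpos.ne'])
    rw [h1, abs_mul, abs_of_nonneg (by positivity), mul_comm]
    gcongr
  have hs0 : 0 ≤ s := (abs_nonneg _).trans (hle1 0 (by simp))
  have hs3 : s ≤ 3 * m := by
    -- Since `s` is finite, the last term can be absorbed, giving `s ≤ 8 / 3 * m`.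
    have : s ≤ m + 5 / 8 * s := by
      refine csSup_le ⟨_, 0, by simp, rfl⟩ ?_
      rintro _ ⟨v, hv, rfl⟩
      rw [mem_closedBall_zero_iff] at hv
      obtain ⟨u, hu, huv⟩ := hN v hv
      set b := (2 : ℝ) • (v - u) with hb
      set c := (1 / 2 : ℝ) • (v + u) with hc
      have hb' : ‖b‖ ≤ 1 / 2 := by
        rw [hb, norm_smul, Real.norm_ofNat]
        linarith
      have hc' : ‖c‖ ≤ 1 := by
        rw [hc, norm_smul, Real.norm_of_nonneg (by norm_num)]
        linarith [norm_add_le v u, hN1 u hu]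
      have hpar := parallelogram_law_with_norm ℝ b c
      have h1 := hle (b + c)
      have h2 := hle (b - c)
      have h3 : 4 * |q v - q u| ≤ s * (5 / 2) := by
        have h4 : 4 * |q v - q u| = |4 * (q v - q u)| := by
          rw [abs_mul, abs_of_pos (by norm_num : (0 : ℝ) < 4)]
        rw [h4, hdiff v u]
        calc |q (b + c) - q (b - c)| ≤ s * ‖b + c‖ ^ 2 + s * ‖b - c‖ ^ 2 :=
              (abs_sub _ _).trans (add_le_add h1 h2)
          _ = s * (2 * (‖b‖ ^ 2 + ‖c‖ ^ 2)) := by rw [← mul_add, hpar]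
          _ ≤ s * (2 * ((1 / 2) ^ 2 + 1 ^ 2)) := by gcongr
          _ = s * (5 / 2) := by ring
      have h4 : |q v| ≤ |q u| + |q v - q u| := by
        have := abs_add_le (q u) (q v - q u)
        rwa [add_sub_cancel] at this
      have h5 := hm u hu
      change |q v| ≤ _
      change |q u| ≤ m at h5
      linarith
    linarith
  exact (hle v).trans (by gcongr)

/-! ### Gaussian exponential moments -/

/-- The series has only even powers, so every nonconstant term gains `m ^ 2`. This quadratic gain
yields `exp (n * m ^ 2)` for `n` factors. -/
theorem cosh_mul_le {m t : ℝ} (hm0 : 0 ≤ m) (hm1 : m ≤ 1) (ht : 0 ≤ t) :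
    Real.cosh (m * t) ≤ 1 + m ^ 2 * (Real.exp t - 1) := by
  have h1 : Real.cosh (m * t) ≤ (1 - m ^ 2) + m ^ 2 * Real.cosh t := by
    refine hasSum_le (fun n => ?_) (Real.hasSum_cosh (m * t))
      ((hasSum_ite_eq 0 (1 - m ^ 2)).add ((Real.hasSum_cosh t).mul_left (m ^ 2)))
    rcases n with _ | n
    · simp
    · have : m ^ (2 * (n + 1)) ≤ m ^ 2 := pow_le_pow_of_le_one hm0 hm1 (by omega)
      simp only [Nat.succ_ne_zero, if_false, zero_add, mul_pow, mul_div_assoc]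
      gcongr
  have h2 : Real.cosh t ≤ Real.exp t := by
    rw [Real.cosh_eq]
    linarith [Real.exp_le_exp.2 (by linarith : -t ≤ t)]
  nlinarith [mul_le_mul_of_nonneg_left h2 (sq_nonneg m)]

theorem integrable_exp_sq_div_four_gaussianReal :
    Integrable (fun y : ℝ => Real.exp (y ^ 2 / 4)) (gaussianReal 0 1) ∧
      ∫ y, Real.exp (y ^ 2 / 4) ∂(gaussianReal 0 1) ≤ 2 := by
  have key : ∀ y : ℝ, gaussianPDFReal 0 1 y • Real.exp (y ^ 2 / 4) =
      (√(2 * Real.pi))⁻¹ * Real.exp (-(1 / 4) * y ^ 2) := fun y => by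
    rw [gaussianPDFReal_def, smul_eq_mul]
    simp only [NNReal.coe_one, mul_one, sub_zero, mul_assoc]
    rw [← Real.exp_add]
    ring_nf
  have hint : ∫ y, Real.exp (y ^ 2 / 4) ∂(gaussianReal 0 1) = √2 := by
    rw [integral_gaussianReal_eq_integral_smul one_ne_zero]
    simp_rw [key]
    rw [integral_const_mul, integral_gaussian, ← Real.sqrt_inv, ← Real.sqrt_mul (by positivity)]
    congr 1
    field_simp
    norm_num
  -- A non-integrable function has integral 0 by convention, so the value `√2` proves integrability.
  refine ⟨.of_integral_ne_zero (by rw [hint]; positivity), ?_⟩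
  rw [hint, Real.sqrt_le_left (by norm_num)]
  norm_num

theorem map_inner_stdGaussian {E : Type*} [NormedAddCommGroup E] [InnerProductSpace ℝ E]
    [FiniteDimensional ℝ E] [MeasurableSpace E] [BorelSpace E] (u : E) :
    (stdGaussian E).map (fun x => inner ℝ u x) =
      (gaussianReal 0 1).map (fun y => ‖u‖ * y) := by
  have h := IsGaussian.map_eq_gaussianReal (μ := stdGaussian E) (innerSL ℝ u)
  rw [variance_dual_stdGaussian, integral_strongDual_stdGaussian, innerSL_apply_norm] at h
  rw [gaussianReal_map_const_mul, mul_zero, mul_one]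
  convert h using 2
  · ext
    simp
  · exact (Real.toNNReal_of_nonneg (sq_nonneg _)).symm

theorem integrable_cosh_sq_inner {E : Type*} [NormedAddCommGroup E] [InnerProductSpace ℝ E]
    [FiniteDimensional ℝ E] [MeasurableSpace E] [BorelSpace E] {u : E} (hu : ‖u‖ ≤ 1)
    {m : ℝ} (hm0 : 0 ≤ m) (hm1 : m ≤ 1) :
    Integrable (fun x => Real.cosh (m / 4 * inner ℝ u x ^ 2)) (stdGaussian E) ∧
      ∫ x, Real.cosh (m / 4 * inner ℝ u x ^ 2) ∂(stdGaussian E) ≤ Real.exp (m ^ 2) := by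
  have hcont : Continuous fun y : ℝ => Real.cosh (m / 4 * y ^ 2) := by fun_prop
  have hpt : ∀ y : ℝ, Real.cosh (m / 4 * (‖u‖ * y) ^ 2) ≤
      1 + m ^ 2 * (Real.exp (y ^ 2 / 4) - 1) := fun y => by
    refine le_trans ?_ (cosh_mul_le hm0 hm1 (by positivity))
    rw [Real.cosh_le_cosh, abs_of_nonneg (by positivity), abs_of_nonneg (by positivity), mul_pow]
    have : ‖u‖ ^ 2 * y ^ 2 ≤ 1 * y ^ 2 := by
      gcongr
      exact pow_le_one₀ (norm_nonneg _) hu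
    nlinarith
  obtain ⟨hexp, hexp2⟩ := integrable_exp_sq_div_four_gaussianReal
  have hdom : Integrable (fun y : ℝ => 1 + m ^ 2 * (Real.exp (y ^ 2 / 4) - 1))
      (gaussianReal 0 1) :=
    (integrable_const _).add ((hexp.sub (integrable_const _)).const_mul _)
  have hint : Integrable (fun y : ℝ => Real.cosh (m / 4 * (‖u‖ * y) ^ 2)) (gaussianReal 0 1) := by
    refine hdom.mono' (by fun_prop) (.of_forall fun y => ?_)
    rw [Real.norm_of_nonneg (Real.cosh_pos _).le]
    exact hpt y
  have hmap := map_inner_stdGaussian u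
  constructor
  · have h1 : Integrable (fun y : ℝ => Real.cosh (m / 4 * y ^ 2))
        ((stdGaussian E).map fun x => inner ℝ u x) := by
      rw [hmap, integrable_map_measure hcont.aestronglyMeasurable (by fun_prop)]
      exact hint
    exact h1.comp_aemeasurable (by fun_prop)
  · have h1 := integral_map (μ := stdGaussian E) (φ := fun x => inner ℝ u x) (by fun_prop)
      hcont.aestronglyMeasurable
    rw [← h1, hmap, integral_map (by fun_prop) hcont.aestronglyMeasurable]
    calc ∫ y, Real.cosh (m / 4 * (‖u‖ * y) ^ 2) ∂(gaussianReal 0 1)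
        ≤ ∫ y, (1 + m ^ 2 * (Real.exp (y ^ 2 / 4) - 1)) ∂(gaussianReal 0 1) :=
          integral_mono hint hdom hpt
      _ = 1 + m ^ 2 * (∫ y, Real.exp (y ^ 2 / 4) ∂(gaussianReal 0 1) - 1) := by
          have hsub : Integrable (fun y : ℝ => m ^ 2 * (Real.exp (y ^ 2 / 4) - 1))
              (gaussianReal 0 1) := (hexp.sub (integrable_const _)).const_mul _
          rw [integral_add (integrable_const _) hsub,
            integral_const_mul, integral_sub hexp (integrable_const _)]
          simp
      _ ≤ 1 + m ^ 2 * (2 - 1) := by gcongr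
      _ ≤ Real.exp (m ^ 2) := by linarith [Real.add_one_le_exp (m ^ 2)]

/-! ### Averaging over the signs -/

theorem sum_sign_exp_eq_prod_cosh {n : ℕ} (y : Fin n → ℝ) :
    (1 / 2 ^ n) * ∑ σ : Fin n → ℤˣ, Real.exp (∑ i, ((σ i : ℤ) : ℝ) * y i) =
      ∏ i, Real.cosh (y i) := by
  have h2 : ∀ i, ∑ e : ℤˣ, Real.exp (((e : ℤ) : ℝ) * y i) = 2 * Real.cosh (y i) := fun i => by
    have : (Finset.univ : Finset ℤˣ) = {1, -1} := rfl
    rw [this, Finset.sum_pair (by decide), Real.cosh_eq]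
    push_cast
    ring_nf
  have h := Finset.prod_univ_sum (fun _ : Fin n => (Finset.univ : Finset ℤˣ))
    (fun i e => Real.exp (((e : ℤ) : ℝ) * y i))
  simp only [h2, Finset.prod_mul_distrib, Finset.prod_const, Finset.card_univ, Fintype.card_fin,
    Fintype.piFinset_univ, ← Real.exp_sum] at h
  rw [← h]
  field_simp

/-- Summing the bound over the rows of `W` gives the squared Frobenius norm, so the width plays no
role. -/
theorem iSup_quadraticNetClass_le {k d n : ℕ} {M B : ℝ} (hB : 0 ≤ B)
    (S : Fin n → EuclideanSpace ℝ (Fin d)) (σ : Fin n → ℤˣ)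
    (h : ∀ v : EuclideanSpace ℝ (Fin d),
      ∑ i, ((σ i : ℤ) : ℝ) * inner ℝ v (S i) ^ 2 ≤ B * ‖v‖ ^ 2) :
    ⨆ f : quadraticNetClass k d M,
      ∑ i, ((σ i : ℤ) : ℝ) * (f : EuclideanSpace ℝ (Fin d) → ℝ) (S i) ≤ B * M ^ 2 := by
  refine Real.iSup_le ?_ (by positivity)
  rintro ⟨_, W, hW, rfl⟩
  have hrow : ∀ j, ∑ i, ((σ i : ℤ) : ℝ) * (∑ l, W j l * S i l) ^ 2 ≤ B * ∑ l, W j l ^ 2 :=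
    fun j => by
      have := h (WithLp.toLp 2 (W j))
      rw [EuclideanSpace.real_norm_sq_eq] at this
      simpa [PiLp.inner_apply, mul_comm] using this
  calc ∑ i, ((σ i : ℤ) : ℝ) * quadraticNet W (S i)
      = ∑ j, ∑ i, ((σ i : ℤ) : ℝ) * (∑ l, W j l * S i l) ^ 2 := by
        simp only [quadraticNet, Finset.mul_sum]
        exact Finset.sum_comm
    _ ≤ ∑ j, B * ∑ l, W j l ^ 2 := Finset.sum_le_sum fun j _ => hrow j
    _ = B * ∑ j, ∑ l, W j l ^ 2 := by rw [Finset.mul_sum]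
    _ ≤ B * M ^ 2 := by
        gcongr
        exact sum_sq_le_of_mem_frobeniusBall hW

/-- The Rademacher complexity of the network class is controlled by the exponential moments of the
signed quadratic forms at the points of a net. -/
theorem rademacherComplexity_quadraticNetClass_le {k d n : ℕ} (M : ℝ)
    (S : Fin n → EuclideanSpace ℝ (Fin d)) (N : Finset (EuclideanSpace ℝ (Fin d)))
    (hN1 : ∀ u ∈ N, ‖u‖ ≤ 1)
    (hN : ∀ v : EuclideanSpace ℝ (Fin d), ‖v‖ ≤ 1 → ∃ u ∈ N, ‖v - u‖ ≤ 1 / 4)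
    {t a : ℝ} (ht : 0 < t)
    (ha : 2 * ∑ u ∈ N, ∏ i, Real.cosh (t * inner ℝ u (S i) ^ 2) ≤ Real.exp a) :
    rademacherComplexity (quadraticNetClass k d M) S ≤ 3 * M ^ 2 * a / (n * t) := by
  let q : (Fin n → ℤˣ) → EuclideanSpace ℝ (Fin d) → ℝ :=
    fun σ v => ∑ i, ((σ i : ℤ) : ℝ) * inner ℝ v (S i) ^ 2
  let G : (Fin n → ℤˣ) → ℝ := fun σ => ∑ u ∈ N, (Real.exp (t * q σ u) + Real.exp (-t * q σ u))
  -- Tangent bound `log G ≤ exp (-a) * G + a - 1`, divided by `t`. Being affine in `G`, it averages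
  -- directly, in place of Jensen's inequality for `log`.
  let b : (Fin n → ℤˣ) → ℝ := fun σ => (Real.exp (-a) * G σ + a - 1) / t
  have hcosh : ∀ s : ℝ, |s| = t → ∀ u, (1 / 2 ^ n) * ∑ σ, Real.exp (s * q σ u) =
      ∏ i, Real.cosh (t * inner ℝ u (S i) ^ 2) := fun s hs u => by
    have h1 := sum_sign_exp_eq_prod_cosh fun i => s * inner ℝ u (S i) ^ 2
    have h2 : ∀ i, Real.cosh (s * inner ℝ u (S i) ^ 2) = Real.cosh (t * inner ℝ u (S i) ^ 2) :=
      fun i => by rw [← Real.cosh_abs, abs_mul, hs, abs_of_nonneg (sq_nonneg _)]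
    simp only [h2] at h1
    rw [← h1]
    congr 1
    refine Finset.sum_congr rfl fun σ _ => ?_
    simp only [q, Finset.mul_sum]
    congr 1
    exact Finset.sum_congr rfl fun i _ => by ring
  have hG : (1 / 2 ^ n) * ∑ σ, G σ = 2 * ∑ u ∈ N, ∏ i, Real.cosh (t * inner ℝ u (S i) ^ 2) := by
    simp only [G]
    rw [Finset.sum_comm, Finset.mul_sum, Finset.mul_sum]
    refine Finset.sum_congr rfl fun u _ => ?_
    rw [Finset.sum_add_distrib, mul_add, hcosh t (abs_of_pos ht),
      hcosh (-t) (by rw [abs_neg, abs_of_pos ht])]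
    ring
  have hb : ∀ σ, ∀ u ∈ N, |q σ u| ≤ b σ := fun σ u hu => by
    have h1 : Real.exp (t * |q σ u|) ≤ G σ := by
      refine le_trans ?_ (Finset.single_le_sum
        (f := fun u => Real.exp (t * q σ u) + Real.exp (-t * q σ u))
        (fun u _ => by positivity) hu)
      rcases abs_choice (q σ u) with h | h <;> rw [h]
      · linarith [Real.exp_pos (-t * q σ u)]
      · rw [mul_neg, ← neg_mul]
        linarith [Real.exp_pos (t * q σ u)]
    have h2 := Real.add_one_le_exp (t * |q σ u| - a)
    have h3 : Real.exp (t * |q σ u| - a) = Real.exp (-a) * Real.exp (t * |q σ u|) := by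
      rw [← Real.exp_add]
      ring_nf
    have h4 := mul_le_mul_of_nonneg_left h1 (Real.exp_pos (-a)).le
    simp only [b]
    rw [le_div_iff₀ ht]
    linarith
  obtain ⟨u₀, hu₀, -⟩ := hN 0 (by simp)
  have hsup : ∀ σ : Fin n → ℤˣ, ⨆ f : quadraticNetClass k d M,
      ∑ i, ((σ i : ℤ) : ℝ) * (f : EuclideanSpace ℝ (Fin d) → ℝ) (S i) ≤ 3 * b σ * M ^ 2 :=
    fun σ => by
      have h0 : 0 ≤ b σ := (abs_nonneg _).trans (hb σ u₀ hu₀)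
      exact iSup_quadraticNetClass_le (by positivity) S σ fun v => (le_abs_self _).trans
        (abs_signed_sum_sq_inner_le _ S (N := N) hN hN1 (hb σ) v)
  have havg : (1 / 2 ^ n) * ∑ σ, b σ ≤ a / t := by
    have h1 : (1 / 2 ^ n) * ∑ σ, b σ =
        (Real.exp (-a) * ((1 / 2 ^ n) * ∑ σ, G σ) + a - 1) / t := by
      have hc : ((Finset.univ : Finset (Fin n → ℤˣ)).card : ℝ) = 2 ^ n := by simp
      simp only [b, ← Finset.sum_div, Finset.sum_sub_distrib, Finset.sum_add_distrib,
        ← Finset.mul_sum, Finset.sum_const, nsmul_eq_mul, hc]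
      field_simp
    rw [h1, hG]
    have h2 := mul_le_mul_of_nonneg_left ha (Real.exp_pos (-a)).le
    rw [← Real.exp_add, neg_add_cancel, Real.exp_zero] at h2
    gcongr
    linarith
  calc rademacherComplexity (quadraticNetClass k d M) S
      ≤ (1 / (n : ℝ)) * ((1 / 2 ^ n) * ∑ σ, 3 * b σ * M ^ 2) := by
        unfold rademacherComplexity
        gcongr with σ
        exact hsup σ
    _ = (1 / (n : ℝ)) * (3 * M ^ 2 * ((1 / 2 ^ n) * ∑ σ, b σ)) := by
        rw [← Finset.sum_mul, ← Finset.mul_sum]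
        ring
    _ ≤ (1 / (n : ℝ)) * (3 * M ^ 2 * (a / t)) := by gcongr
    _ = 3 * M ^ 2 * a / (n * t) := by
        field_simp

/-! ### Independent samples and the high-probability bound -/

/-- Exponential moment bound for the product of hyperbolic cosines, for independent standard
Gaussian vectors. -/
theorem integrable_prod_cosh_sq_inner {E : Type*} [NormedAddCommGroup E] [InnerProductSpace ℝ E]
    [FiniteDimensional ℝ E] [MeasurableSpace E] [BorelSpace E] {n : ℕ} {Ω : Type*}
    [MeasurableSpace Ω] {P : Measure Ω} [IsProbabilityMeasure P] {x : Fin n → Ω → E}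
    (hx : iIndepFun x P) (hlaw : ∀ i, HasLaw (x i) (stdGaussian E) P) {u : E} (hu : ‖u‖ ≤ 1)
    {m : ℝ} (hm0 : 0 ≤ m) (hm1 : m ≤ 1) :
    Integrable (fun ω => ∏ i, Real.cosh (m / 4 * inner ℝ u (x i ω) ^ 2)) P ∧
      ∫ ω, ∏ i, Real.cosh (m / 4 * inner ℝ u (x i ω) ^ 2) ∂P ≤ Real.exp (n * m ^ 2) := by
  obtain ⟨hint, hle⟩ := integrable_cosh_sq_inner hu hm0 hm1
  have hcont : Continuous fun y : E => Real.cosh (m / 4 * inner ℝ u y ^ 2) := by fun_prop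
  have hprod : ∫ ω, ∏ i, Real.cosh (m / 4 * inner ℝ u (x i ω) ^ 2) ∂P =
      (∫ y, Real.cosh (m / 4 * inner ℝ u y ^ 2) ∂(stdGaussian E)) ^ n := by
    rw [hx.integral_fun_prod_comp (f := fun _ y => Real.cosh (m / 4 * inner ℝ u y ^ 2))
      (fun i => (hlaw i).aemeasurable) (fun i => hcont.aestronglyMeasurable)]
    have : ∀ i, ∫ ω, Real.cosh (m / 4 * inner ℝ u (x i ω) ^ 2) ∂P =
        ∫ y, Real.cosh (m / 4 * inner ℝ u y ^ 2) ∂(stdGaussian E) := fun i =>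
      (hlaw i).integral_comp hcont.aestronglyMeasurable
    simp [this]
  have hpos : 1 ≤ ∫ y, Real.cosh (m / 4 * inner ℝ u y ^ 2) ∂(stdGaussian E) := by
    have := integral_mono (integrable_const (1 : ℝ)) hint fun y => Real.one_le_cosh _
    simpa using this
  refine ⟨.of_integral_ne_zero (by rw [hprod]; positivity), ?_⟩
  rw [hprod, Real.exp_nat_mul]
  gcongr

theorem corollary5 :
    ∃ C : ℝ, 0 < C ∧
      ∀ (d k n : ℕ) (M : ℝ), 1 ≤ d → 1 ≤ k → 1 ≤ n → 0 ≤ M →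
        (d : ℝ) * Real.log d ≤ n →
        ∀ {Ω : Type*} [MeasurableSpace Ω] (μ : Measure Ω) [IsProbabilityMeasure μ]
          (x : Fin n → Ω → EuclideanSpace ℝ (Fin d)),
          iIndepFun x μ →
          (∀ i, HasLaw (x i) (stdGaussian (EuclideanSpace ℝ (Fin d))) μ) →
          1 - C / (d : ℝ) ≤
            μ.real {ω | rademacherComplexity (quadraticNetClass k d M) (fun i => x i ω) ≤
              C * Real.sqrt (M ^ 4 * d / n)} := by
  -- `72 = 3 * 6 * 4`: net loss 3, threshold `exp (6 * d)`, and `t = m / 4`.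
  refine ⟨72, by norm_num, ?_⟩
  intro d k n M hd _ hn _ hdn Ω _ μ _ x hx hlaw
  have hd0 : (0 : ℝ) < d := by exact_mod_cast hd
  have hn0 : (0 : ℝ) < n := by exact_mod_cast hn
  -- For `d < 3` the claimed probability is negative. Otherwise `log d ≥ 1`, so `d ≤ n`, which is
  -- what `m ≤ 1` requires.
  rcases lt_or_ge d 3 with hd3 | hd3
  · refine le_trans ?_ measureReal_nonneg
    have : (d : ℝ) ≤ 72 := by exact_mod_cast (by omega : d ≤ 72)
    rw [sub_nonpos, one_le_div hd0]
    exact this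
  have hdle : (d : ℝ) ≤ n := by
    have h3 : (3 : ℝ) ≤ d := by exact_mod_cast hd3
    have hlog : 1 ≤ Real.log d := by
      rw [Real.le_log_iff_exp_le hd0]
      linarith [Real.exp_one_lt_d9]
    nlinarith
  set m : ℝ := √((d : ℝ) / n) with hm
  have hm0 : 0 < m := by positivity
  have hm1 : m ≤ 1 := by
    rw [hm, Real.sqrt_le_left zero_le_one, one_pow]
    exact (div_le_one hn0).2 hdle
  have hm2 : n * m ^ 2 = d := by
    rw [hm, Real.sq_sqrt (by positivity)]
    field_simp
  obtain ⟨N, hN1, hcard, hN⟩ := exists_quarter_net (EuclideanSpace ℝ (Fin d))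
  rw [finrank_euclideanSpace_fin] at hcard
  set F : Ω → ℝ := fun ω => 2 * ∑ u ∈ N, ∏ i, Real.cosh (m / 4 * inner ℝ u (x i ω) ^ 2) with hF
  have hF0 : ∀ ω, 0 ≤ F ω := fun ω => by
    simp only [hF]
    exact mul_nonneg two_pos.le (Finset.sum_nonneg fun u _ => Finset.prod_nonneg fun i _ =>
      (Real.cosh_pos _).le)
  have hmom := fun u (hu : u ∈ N) =>
    integrable_prod_cosh_sq_inner hx hlaw (hN1 u hu) hm0.le hm1
  have hFint : Integrable F μ :=
    (integrable_finsetSum N fun u hu => (hmom u hu).1).const_mul 2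
  have hFle : ∫ ω, F ω ∂μ ≤ 2 * (9 ^ d * Real.exp d) := by
    simp only [hF]
    rw [integral_const_mul, integral_finsetSum N fun u hu => (hmom u hu).1]
    have h1 : ∑ u ∈ N, ∫ ω, ∏ i, Real.cosh (m / 4 * inner ℝ u (x i ω) ^ 2) ∂μ ≤
        ∑ _u ∈ N, Real.exp d :=
      Finset.sum_le_sum fun u hu => (hmom u hu).2.trans (by rw [hm2])
    rw [Finset.sum_const, nsmul_eq_mul] at h1
    have h2 : (N.card : ℝ) ≤ 9 ^ d := by exact_mod_cast hcard
    have h3 : (N.card : ℝ) * Real.exp d ≤ 9 ^ d * Real.exp d := by gcongr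
    linarith
  -- The spare factor `d` becomes the failure probability `1 / d` in Markov's inequality.
  have hnum : d * (2 * (9 ^ d * Real.exp d)) ≤ Real.exp (6 * d) := by
    have h1 : (9 : ℝ) ^ d ≤ Real.exp (3 * d) := by
      rw [mul_comm, Real.exp_nat_mul]
      gcongr
      have h4 : Real.exp 3 = Real.exp 1 ^ 3 := by rw [← Real.exp_nat_mul]; norm_num
      have h5 : (2.7 : ℝ) ^ 3 ≤ Real.exp 1 ^ 3 := by
        gcongr
        linarith [Real.exp_one_gt_d9]
      rw [h4]
      linarith
    have h2 : 2 * (d : ℝ) ≤ Real.exp (2 * d) := by linarith [Real.add_one_le_exp (2 * (d : ℝ))]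
    calc d * (2 * (9 ^ d * Real.exp d)) = 2 * d * (9 ^ d * Real.exp d) := by ring
      _ ≤ Real.exp (2 * d) * (Real.exp (3 * d) * Real.exp d) := by gcongr
      _ = Real.exp (6 * d) := by
        rw [← Real.exp_add, ← Real.exp_add]
        ring_nf
  have hbad : μ.real {ω | Real.exp (6 * d) ≤ F ω} ≤ 1 / d := by
    have h1 := mul_meas_ge_le_integral_of_nonneg (.of_forall hF0) hFint (Real.exp (6 * d))
    have h2 : Real.exp (6 * d) * μ.real {ω | Real.exp (6 * d) ≤ F ω} ≤
        Real.exp (6 * d) * (1 / d) := by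
      refine (h1.trans hFle).trans ?_
      rw [mul_one_div, le_div_iff₀ hd0]
      linarith
    exact le_of_mul_le_mul_left h2 (Real.exp_pos _)
  have hgood : {ω | Real.exp (6 * d) ≤ F ω}ᶜ ⊆
      {ω | rademacherComplexity (quadraticNetClass k d M) (fun i => x i ω) ≤
        72 * √(M ^ 4 * d / n)} := fun ω hω => by
    have hω' : F ω ≤ Real.exp (6 * d) := (not_le.1 (show ¬Real.exp (6 * d) ≤ F ω from hω)).le
    refine (rademacherComplexity_quadraticNetClass_le M (fun i => x i ω) N hN1 hN
      (by positivity : 0 < m / 4) hω').trans_eq ?_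
    have h1 : √(M ^ 4 * d / n) = M ^ 2 * m := by
      rw [mul_div_assoc, Real.sqrt_mul (by positivity), show M ^ 4 = (M ^ 2) ^ 2 by ring,
        Real.sqrt_sq (by positivity)]
    rw [h1, ← hm2]
    field_simp
    ring
  -- Subadditivity suffices, so the event need not be measurable.
  have hcompl : 1 ≤ μ.real {ω | Real.exp (6 * d) ≤ F ω} +
      μ.real {ω | Real.exp (6 * d) ≤ F ω}ᶜ := by
    have := measureReal_union_le (μ := μ) {ω | Real.exp (6 * d) ≤ F ω}
      {ω | Real.exp (6 * d) ≤ F ω}ᶜ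
    rwa [Set.union_compl_self, probReal_univ] at this
  have hmono := measureReal_mono (μ := μ) hgood
  have hC : 1 / (d : ℝ) ≤ 72 / d := by
    gcongr
    norm_num
  linarith
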